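/- Let $\mathbb D_-=\{z:|z|>1\}\cup\{\infty\}$ and $\mathbb T=\mathbb R/2\pi\mathbb Z$. Let $\Sigma'$ be the class of univalent maps $\phi:\mathbb D_-\to\mathbb D_-$ with $\phi(\infty)=\infty$ and $\phi'(\infty)>0$, i.e. $\phi(z)=bz+\dots$ near $\infty$ with $b>0$. For $\theta\in\mathbb T$ put $\phi_\theta(z)=e^{i\theta}\phi(e^{-i\theta}z)$, and for $n\ge 1$ let $K_n\phi(z)=\phi(z^n)^{1/n}$ be the Koebe $n$-root transform (the holomorphic branch on $\mathbb D_-$ with positive derivative at $\infty$). Let $\phi\in\Sigma'$ and let $k\ge 2$ be an integer. For a sequence $(\theta_n)_{n\ge 0}$ in $\mathbb T$ put $f_0=\phi_{\theta_0}$ and $f_n=f_{n-1}\circ K_{k^n}\phi_{\theta_n}$ for $n\ge 1$. Then the limit $f=\lim_n f_n$ exists locally uniformly on $\{1<|z|<\infty\}$ and belongs to $\Sigma'$. Let $g=f^{-1}$ on $f(\mathbb D_-)$, extended by $g=0$ on the complement $S=\mathbb C\setminus f(\mathbb D_-)$ (so $g(z)=0$ if and only if $z\in S$). Here $g'(z)$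 is the usual derivative for $z\in f(\mathbb D_-)\setminus\{\infty\}$, and $g'(z)=0$ for $z\in S$. Suppose now that the $\theta_n$ are independent random variables, each uniformly distributed on $\mathbb T$, so that $f$ and $g$ are random. Then: 1. (Rotational invariance.) For every $\omega\in\mathbb R$ the random functions $z\mapsto g(z)$ and $z\mapsto e^{i\omega}g(e^{-i\omega}z)$, $z\in\mathbb C$, have the same distribution (on the space of functions $\mathbb C\to\mathbb C$ with the product $\sigma$-algebra). 2. For $z\in\mathbb C$ the distributions of $|g(z)|$ and of $|g'(z)|$ depend only on $|z|$; for $1<|z|<\infty$ the distributions of $|f(z)|$ and of $|f'(z)|$ depend only on $|z|$. -/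

import Mathlib

open MeasureTheory ProbabilityTheory Filter Topology Set

/-- The finite part `{z : |z| > 1}` of the exterior disk `D₋ = {|z| > 1} ∪ {∞}`. -/
def exteriorDisk : Set ℂ := {z | 1 < ‖z‖}

/-- The behaviour `h(∞) = ∞`, `h'(∞) > 0`: the expansion of `h` at infinity is `h(z) = b z + …`
with `b` real and positive. -/
def NormalizedAtInfinity (h : ℂ → ℂ) : Prop :=
  ∃ b : ℝ, 0 < b ∧ Tendsto (fun z => h z / z) (Bornology.cobounded ℂ) (𝓝 (b : ℂ))

/-- The class `Σ'` of univalent self-maps of `D₋` with `φ(∞) = ∞` and `φ'(∞) > 0`. Maps are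
represented by total functions on `ℂ`; only the values on `exteriorDisk` matter. -/
structure SigmaPrime (φ : ℂ → ℂ) : Prop where
  differentiableOn : DifferentiableOn ℂ φ exteriorDisk
  injOn : InjOn φ exteriorDisk
  mapsTo : MapsTo φ exteriorDisk exteriorDisk
  normalized : NormalizedAtInfinity φ

/-- The circle `𝕋 = ℝ / 2πℤ` of angles. -/
abbrev Angles : Type := AddCircle (2 * Real.pi)

/-- The normalised Lebesgue (Haar) measure on `𝕋`. -/
noncomputable def uniformAngle : Measure Angles :=
  haveI : Fact (0 < 2 * Real.pi) := ⟨Real.two_pi_pos⟩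
  AddCircle.haarAddCircle

/-- The rotated map `φ_θ(z) = e^{iθ} φ(e^{-iθ} z)`. -/
noncomputable def rotated (φ : ℂ → ℂ) (θ : Angles) : ℂ → ℂ :=
  fun z => (AddCircle.toCircle θ : ℂ) * φ ((AddCircle.toCircle (-θ) : ℂ) * z)

/-- `h` is the `n`-th root transform of `φ`: the holomorphic branch of `φ(zⁿ)^{1/n}` on `D₋`
whose derivative at infinity is positive. -/
structure IsKoebeTransform (n : ℕ) (φ h : ℂ → ℂ) : Prop where
  differentiableOn : DifferentiableOn ℂ h exteriorDisk
  pow_eq : ∀ z ∈ exteriorDisk, h z ^ n = φ (z ^ n)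
  normalized : NormalizedAtInfinity h

/-- The Koebe `n`-root transform `K_n φ`. For `φ ∈ Σ'` and `n ≥ 1` the branch exists, and its values
on `exteriorDisk` are unique. -/
noncomputable def koebe (n : ℕ) (φ : ℂ → ℂ) : ℂ → ℂ :=
  Classical.epsilon (IsKoebeTransform n φ)

/-- The approximations `f₀ = φ_{θ₀}` and `f_n = f_{n-1} ∘ K_{k^n} φ_{θ_n}`. -/
noncomputable def snowflakeApprox (φ : ℂ → ℂ) (k : ℕ) (θ : ℕ → Angles) : ℕ → ℂ → ℂ
  | 0 => rotated φ (θ 0)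
  | n + 1 => fun z => snowflakeApprox φ k θ n (koebe (k ^ (n + 1)) (rotated φ (θ (n + 1))) z)

/-- The conformal snowflake `f = lim f_n`, as a function on `exteriorDisk`. -/
noncomputable def snowflake (φ : ℂ → ℂ) (k : ℕ) (θ : ℕ → Angles) : ℂ → ℂ :=
  fun z => limUnder atTop (fun n => snowflakeApprox φ k θ n z)

open Classical in
/-- The inverse `g = f⁻¹ : f(D₋) → D₋`, extended by `0` to the complement `S = ℂ \ f(D₋)`.
As `|g| > 1` on `f(D₋)`, the extension also records the (random) domain of `g`. -/
noncomputable def inverseSnowflake (φ : ℂ → ℂ) (k : ℕ) (θ : ℕ → Angles) : ℂ → ℂ :=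
  fun w =>
    if w ∈ snowflake φ k θ '' exteriorDisk then
      Function.invFunOn (snowflake φ k θ) exteriorDisk w
    else 0

/-! Write `φ z = z * exp (L (1/z))` with `L` holomorphic on the unit disk. The Schwarz lemma gives
`Re L ≥ 0`. Then `K_n φ_θ` is the explicit map `z * exp (L (u * z⁻ⁿ) / n)`, `u = e^{iθ}`
(`IsLogRatio.koebe_rotated`), which never decreases `‖z‖`. On `‖z‖ ≥ r > 1` the factor at level `n`
has an exponent of size `O(2⁻ⁿ)`, uniformly in the angles, so the tails of the composition are close
to the identity. With a Lipschitz bound for the finite compositions that is uniform in their length,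
this gives geometric convergence, joint continuity of the limit in angles and point, and membership
in `Σ'`.

Invariance comes from one identity: multiplying `u` by `vⁿ` conjugates the level-`n` map by the
rotation `v` (`rootMap_mul_pow`). Replacing `θ_n` by `θ_n + kⁿ α` therefore rotates `f`, and hence
`g`, by `α`. Such a shift preserves the law of independent uniform angles, and measurability of `g`,
`g'`, `f`, `f'` in the angles transfers this to the random functions. -/

theorem isOpen_exteriorDisk : IsOpen exteriorDisk :=
  isOpen_lt continuous_const continuous_norm

theorem exteriorDisk_mem_cobounded : exteriorDisk ∈ Bornology.cobounded ℂ := by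
  have := (tendsto_norm_cobounded_atTop (E := ℂ)).eventually_gt_atTop 1
  exact this

theorem ne_zero_of_mem_exteriorDisk {z : ℂ} (hz : z ∈ exteriorDisk) : z ≠ 0 := by
  rintro rfl
  simp only [exteriorDisk, mem_ofPred_eq, norm_zero] at hz
  linarith

theorem isPreconnected_exteriorDisk : IsPreconnected exteriorDisk := by
  have h : exteriorDisk =
      (fun p : ℝ × ℝ => (p.1 : ℂ) * Complex.exp (p.2 * Complex.I)) '' (Ioi (1 : ℝ) ×ˢ univ) := by
    ext z
    constructor
    · intro hz
      exact ⟨(‖z‖, z.arg), ⟨hz, mem_univ _⟩, Complex.norm_mul_exp_arg_mul_I z⟩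
    · rintro ⟨⟨r, a⟩, ⟨hr, -⟩, rfl⟩
      have hr' : (1 : ℝ) < r := hr
      simp only [exteriorDisk, mem_ofPred_eq, norm_mul, Complex.norm_exp_ofReal_mul_I, mul_one,
        Complex.norm_real, Real.norm_eq_abs]
      exact hr'.trans_le (le_abs_self r)
  rw [h]
  exact (isPreconnected_Ioi.prod isPreconnected_univ).image _ (by fun_prop)

/-! ### The logarithm of `φ z / z` -/

/-- `L` is a branch of `log (φ z / z)` in the coordinate `1 / z`, real at infinity and with
nonnegative real part. -/
structure IsLogRatio (φ L : ℂ → ℂ) : Prop where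
  differentiableOn : DifferentiableOn ℂ L (Metric.ball 0 1)
  im_zero : (L 0).im = 0
  re_nonneg : ∀ ζ ∈ Metric.ball (0 : ℂ) 1, 0 ≤ (L ζ).re
  eq_mul_exp : ∀ z ∈ exteriorDisk, φ z = z * Complex.exp (L z⁻¹)

/-- A zero-free holomorphic function on the unit disk has a holomorphic logarithm with a prescribed
admissible value at the center. -/
theorem exists_log_of_differentiableOn_ball {Q : ℂ → ℂ}
    (hQ : DifferentiableOn ℂ Q (Metric.ball 0 1)) (hne : ∀ ζ ∈ Metric.ball (0 : ℂ) 1, Q ζ ≠ 0)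
    {c : ℂ} (hc : Complex.exp c = Q 0) :
    ∃ L : ℂ → ℂ, DifferentiableOn ℂ L (Metric.ball 0 1) ∧ L 0 = c ∧
      ∀ ζ ∈ Metric.ball (0 : ℂ) 1, Complex.exp (L ζ) = Q ζ := by
  obtain ⟨L, hL0, hL⟩ := Complex.IsExactOn.with_val_at
    (((hQ.deriv Metric.isOpen_ball).div hQ hne).isExactOn_ball) 0 c
  have hLd : DifferentiableOn ℂ L (Metric.ball 0 1) := fun ζ hζ =>
    (hL ζ hζ).differentiableAt.differentiableWithinAt
  refine ⟨L, hLd, hL0, fun ζ hζ => ?_⟩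
  have hder : ∀ x ∈ Metric.ball (0 : ℂ) 1,
      HasDerivAt (fun x => Q x * Complex.exp (-L x)) 0 x := by
    intro x hx
    have h1 : HasDerivAt Q (deriv Q x) x :=
      (hQ.differentiableAt (Metric.isOpen_ball.mem_nhds hx)).hasDerivAt
    convert! h1.mul (hL x hx).neg.cexp using 1
    have := hne x hx
    simp only [Pi.div_apply]
    field_simp
    ring
  have hconst := Metric.isOpen_ball.is_const_of_deriv_eq_zero
    (convex_ball (0 : ℂ) 1).isPreconnected
    (fun x hx => (hder x hx).differentiableAt.differentiableWithinAt)
    (fun x hx => (hder x hx).deriv) hζ (Metric.mem_ball_self one_pos)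
  simp only [hL0, ← hc, ← Complex.exp_add, add_neg_cancel, Complex.exp_zero] at hconst
  rw [Complex.exp_neg] at hconst
  field_simp at hconst
  exact hconst.symm

theorem inv_mem_exteriorDisk {ζ : ℂ} (hζ : ζ ∈ Metric.ball (0 : ℂ) 1) (h0 : ζ ≠ 0) :
    ζ⁻¹ ∈ exteriorDisk := by
  rw [mem_ball_zero_iff] at hζ
  simp only [exteriorDisk, mem_ofPred_eq, norm_inv]
  exact (one_lt_inv₀ (norm_pos_iff.2 h0)).2 hζ

theorem inv_mem_ball {z : ℂ} (hz : z ∈ exteriorDisk) : z⁻¹ ∈ Metric.ball (0 : ℂ) 1 := by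
  rw [mem_ball_zero_iff, norm_inv]
  exact inv_lt_one_of_one_lt₀ hz

/-- The map `ζ ↦ ζ * φ (1/ζ)` has a removable singularity at 0 with value `b > 0` and no zeros, so
it has a logarithm `L` with `L 0 = log b`. Since `1 / φ (1/ζ) = ζ * exp (-L ζ)` maps the disk to
itself and fixes 0, the Schwarz lemma forces `|exp (-L)| ≤ 1`. -/
theorem SigmaPrime.exists_isLogRatio {φ : ℂ → ℂ} (hφ : SigmaPrime φ) :
    ∃ L, IsLogRatio φ L := by
  obtain ⟨b, hb, hlim⟩ := hφ.normalized
  have hball : Metric.ball (0 : ℂ) 1 ∈ 𝓝 (0 : ℂ) := Metric.ball_mem_nhds _ one_pos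
  set Q : ℂ → ℂ := Function.update (fun ζ => ζ * φ ζ⁻¹) 0 (b : ℂ) with hQ
  have hQne : ∀ ζ : ℂ, ζ ≠ 0 → Q ζ = ζ * φ ζ⁻¹ := fun ζ h => Function.update_of_ne h _ _
  have hQ0 : Q 0 = b := Function.update_self _ _ _
  have hQd : DifferentiableOn ℂ Q (Metric.ball 0 1) := by
    refine (Complex.differentiableOn_compl_singleton_and_continuousAt_iff hball).1 ⟨?_, ?_⟩
    · have : DifferentiableOn ℂ (fun ζ => ζ * φ ζ⁻¹) (Metric.ball 0 1 \ {0}) := by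
        refine differentiableOn_id.mul (hφ.differentiableOn.comp
          (differentiableOn_inv.mono fun ζ h => h.2) fun ζ h => inv_mem_exteriorDisk h.1 h.2)
      exact this.congr fun ζ h => hQne ζ h.2
    · rw [hQ, continuousAt_update_same]
      refine (hlim.comp tendsto_inv₀_nhdsNE_zero).congr fun ζ => ?_
      simp [div_eq_mul_inv, mul_comm]
  have hφne : ∀ z ∈ exteriorDisk, φ z ≠ 0 := fun z hz =>
    ne_zero_of_mem_exteriorDisk (hφ.mapsTo hz)
  have hQz : ∀ ζ ∈ Metric.ball (0 : ℂ) 1, Q ζ ≠ 0 := by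
    intro ζ hζ
    by_cases h : ζ = 0
    · rw [h, hQ0]; exact_mod_cast hb.ne'
    · rw [hQne ζ h]
      exact mul_ne_zero h (hφne _ (inv_mem_exteriorDisk hζ h))
  obtain ⟨L, hLd, hL0, hL⟩ := exists_log_of_differentiableOn_ball hQd hQz
    (c := (Real.log b : ℝ)) (by rw [hQ0, ← Complex.ofReal_exp, Real.exp_log hb])
  have hexp : ∀ ζ ∈ Metric.ball (0 : ℂ) 1, ζ ≠ 0 →
      ζ * Complex.exp (-L ζ) = (φ ζ⁻¹)⁻¹ := by
    intro ζ hζ h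
    rw [Complex.exp_neg, hL ζ hζ, hQne ζ h, mul_inv, mul_inv_cancel_left₀ h]
  have hschwarz : ∀ ζ ∈ Metric.ball (0 : ℂ) 1, ‖ζ * Complex.exp (-L ζ)‖ ≤ ‖ζ‖ := by
    intro ζ hζ
    refine Complex.norm_le_norm_of_mapsTo_ball (R := 1)
      (f := fun ζ => ζ * Complex.exp (-L ζ)) (differentiableOn_id.mul hLd.neg.cexp) ?_ (by simp)
      (mem_ball_zero_iff.1 hζ)
    intro x hx
    rw [mem_closedBall_zero_iff]
    change ‖x * Complex.exp (-L x)‖ ≤ 1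
    by_cases h : x = 0
    · simp [h]
    · rw [hexp x hx h, norm_inv]
      exact inv_le_one_of_one_le₀ (le_of_lt (hφ.mapsTo (inv_mem_exteriorDisk hx h)))
  have hre : ∀ ζ ∈ Metric.ball (0 : ℂ) 1, ζ ≠ 0 → 0 ≤ (L ζ).re := by
    intro ζ hζ h
    have h1 := hschwarz ζ hζ
    rw [norm_mul, Complex.norm_exp, mul_le_iff_le_one_right (norm_pos_iff.2 h),
      Real.exp_le_one_iff] at h1
    simpa using h1
  refine ⟨L, hLd, by rw [hL0, Complex.ofReal_im], fun ζ hζ => ?_, fun z hz => ?_⟩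
  · by_cases h : ζ = 0
    · subst h
      -- The Schwarz inequality is vacuous at 0; the sign there follows by continuity.
      have ht : Tendsto (fun x => (L x).re) (𝓝[≠] 0) (𝓝 (L 0).re) :=
        (Complex.continuous_re.continuousAt.comp
          (hLd.continuousOn.continuousAt hball)).mono_left nhdsWithin_le_nhds
      refine ge_of_tendsto ht ?_
      filter_upwards [self_mem_nhdsWithin, mem_nhdsWithin_of_mem_nhds hball] with x hx hx'
      exact hre x hx' hx
    · exact hre ζ hζ h
  · have h0 := ne_zero_of_mem_exteriorDisk hz
    rw [hL _ (inv_mem_ball hz), hQne _ (inv_ne_zero h0), inv_inv, mul_inv_cancel_left₀ h0]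

/-! ### Koebe root transforms: uniqueness and explicit form -/

/-- Two `n`-th root transforms of a zero-free function agree. -/
theorem IsKoebeTransform.eqOn {n : ℕ} (hn : n ≠ 0) {ψ h₁ h₂ : ℂ → ℂ}
    (h1 : IsKoebeTransform n ψ h₁) (h2 : IsKoebeTransform n ψ h₂)
    (hne : ∀ z ∈ exteriorDisk, h₂ z ≠ 0) : EqOn h₁ h₂ exteriorDisk := by
  obtain ⟨b₁, hb₁, hl₁⟩ := h1.normalized
  obtain ⟨b₂, hb₂, hl₂⟩ := h2.normalized
  have hb₂' : (b₂ : ℂ) ≠ 0 := by exact_mod_cast hb₂.ne'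
  have hpow : ∀ z ∈ exteriorDisk, (h₁ z / h₂ z) ^ n = 1 := by
    intro z hz
    rw [div_pow, h1.pow_eq z hz, ← h2.pow_eq z hz, div_self (pow_ne_zero _ (hne z hz))]
  have hcont : ContinuousOn (fun z => h₁ z / h₂ z) exteriorDisk :=
    h1.differentiableOn.continuousOn.div h2.differentiableOn.continuousOn hne
  have hfin : {ζ : ℂ | ζ ^ n = 1}.Finite := by
    refine (Polynomial.nthRoots n (1 : ℂ)).toFinset.finite_toSet.subset fun ζ hζ => ?_
    simpa [Polynomial.mem_nthRoots (Nat.pos_of_ne_zero hn)] using hζ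
  -- The quotient takes values in the finite set of `n`-th roots of unity, so it is constant on the
  -- connected exterior disk. Its limit at infinity is a positive real, hence 1.
  have hsub := hfin.countable.isTotallyDisconnected _
    (image_subset_iff.2 fun z hz => hpow z hz) (isPreconnected_exteriorDisk.image _ hcont)
  have hlim : Tendsto (fun z => h₁ z / h₂ z) (Bornology.cobounded ℂ) (𝓝 ((b₁ : ℂ) / b₂)) := by
    refine (hl₁.div hl₂ hb₂').congr' ?_
    filter_upwards [exteriorDisk_mem_cobounded] with z hz
    exact div_div_div_cancel_right₀ (ne_zero_of_mem_exteriorDisk hz) _ _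
  intro z hz
  have hc : h₁ z / h₂ z = (b₁ : ℂ) / b₂ := by
    refine tendsto_nhds_unique (tendsto_const_nhds.congr' ?_) hlim
    filter_upwards [exteriorDisk_mem_cobounded] with w hw
    exact hsub (mem_image_of_mem _ hz) (mem_image_of_mem _ hw)
  have h3 := hpow z hz
  rw [hc] at h3
  have h4 : (b₁ / b₂) ^ n = (1 : ℝ) := by exact_mod_cast h3
  have h5 : b₁ / b₂ = 1 := (pow_eq_one_iff_of_nonneg (by positivity) hn).1 h4
  have h6 : h₁ z / h₂ z = 1 := by rw [hc]; exact_mod_cast h5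
  exact (div_eq_one_iff_eq (hne z hz)).1 h6

/-- The explicit `n`-th root transform of the rotation by `u` of `z ↦ z exp (L (1 / z))`. -/
noncomputable def rootMap (L : ℂ → ℂ) (n : ℕ) (u : Circle) (z : ℂ) : ℂ :=
  z * Complex.exp (L (u * (z ^ n)⁻¹) / n)

theorem mul_inv_pow_mem_ball {n : ℕ} (hn : n ≠ 0) (u : Circle) {z : ℂ} (hz : z ∈ exteriorDisk) :
    (u : ℂ) * (z ^ n)⁻¹ ∈ Metric.ball (0 : ℂ) 1 := by
  rw [mem_ball_zero_iff, norm_mul, Circle.norm_coe, one_mul, norm_inv, norm_pow]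
  exact inv_lt_one_of_one_lt₀ (one_lt_pow₀ hz hn)

namespace IsLogRatio

variable {φ L : ℂ → ℂ}

theorem differentiableOn_rootMap (h : IsLogRatio φ L) {n : ℕ} (hn : n ≠ 0) (u : Circle) :
    DifferentiableOn ℂ (rootMap L n u) exteriorDisk := by
  have h1 : DifferentiableOn ℂ (fun z : ℂ => (u : ℂ) * (z ^ n)⁻¹) exteriorDisk :=
    ((differentiableOn_pow n).fun_inv
      fun z hz => pow_ne_zero n (ne_zero_of_mem_exteriorDisk hz)).const_mul _
  exact differentiableOn_id.mul (((h.differentiableOn.comp h1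
    fun z hz => mul_inv_pow_mem_ball hn u hz).div_const _).cexp)

theorem continuousOn_rootMap (h : IsLogRatio φ L) {n : ℕ} (hn : n ≠ 0) :
    ContinuousOn (fun p : Circle × ℂ => rootMap L n p.1 p.2) (univ ×ˢ exteriorDisk) := by
  have h1 : ContinuousOn (fun p : Circle × ℂ => (p.1 : ℂ) * (p.2 ^ n)⁻¹)
      (univ ×ˢ exteriorDisk) := by
    refine ContinuousOn.mul (by fun_prop) (ContinuousOn.inv₀ (by fun_prop) ?_)
    exact fun p hp => pow_ne_zero n (ne_zero_of_mem_exteriorDisk hp.2)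
  exact continuousOn_snd.mul (((h.differentiableOn.continuousOn.comp h1
    fun p hp => mul_inv_pow_mem_ball hn p.1 hp.2).div_const _).cexp)

theorem norm_le_norm_rootMap (h : IsLogRatio φ L) {n : ℕ} (hn : n ≠ 0) (u : Circle) {z : ℂ}
    (hz : z ∈ exteriorDisk) : ‖z‖ ≤ ‖rootMap L n u z‖ := by
  rw [rootMap, norm_mul, Complex.norm_exp]
  refine le_mul_of_one_le_right (norm_nonneg _) (Real.one_le_exp ?_)
  rw [Complex.div_natCast_re]
  exact div_nonneg (h.re_nonneg _ (mul_inv_pow_mem_ball hn u hz)) n.cast_nonneg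

theorem mapsTo_rootMap (h : IsLogRatio φ L) {n : ℕ} (hn : n ≠ 0) (u : Circle) :
    MapsTo (rootMap L n u) exteriorDisk exteriorDisk := fun _ hz =>
  lt_of_lt_of_le hz (h.norm_le_norm_rootMap hn u hz)

theorem rootMap_pow (h : IsLogRatio φ L) {n : ℕ} (hn : n ≠ 0) (u : Circle) {z : ℂ}
    (hz : z ∈ exteriorDisk) :
    rootMap L n u z ^ n = u * φ ((u : ℂ)⁻¹ * z ^ n) := by
  have hn' : (n : ℂ) ≠ 0 := by exact_mod_cast hn
  have h1 : (u : ℂ)⁻¹ * z ^ n ∈ exteriorDisk := by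
    simp only [exteriorDisk, mem_ofPred_eq, norm_mul, norm_inv, Circle.norm_coe, inv_one, one_mul,
      norm_pow]
    exact one_lt_pow₀ hz hn
  rw [h.eq_mul_exp _ h1, rootMap, mul_pow, ← Complex.exp_nat_mul, mul_div_cancel₀ _ hn', mul_inv,
    inv_inv, mul_assoc (u : ℂ)⁻¹, mul_inv_cancel_left₀ u.coe_ne_zero]

theorem tendsto_rootMap_div (h : IsLogRatio φ L) {n : ℕ} (hn : n ≠ 0) (u : Circle) :
    Tendsto (fun z => rootMap L n u z / z) (Bornology.cobounded ℂ)
      (𝓝 (Real.exp ((L 0).re / n) : ℝ)) := by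
  have h0 : L 0 = ((L 0).re : ℝ) := Complex.ext (by simp) (by simp [h.im_zero])
  have h1 : Tendsto (fun z : ℂ => (u : ℂ) * (z ^ n)⁻¹) (Bornology.cobounded ℂ) (𝓝 0) := by
    have := ((tendsto_inv₀_cobounded (α := ℂ)).pow n).const_mul (u : ℂ)
    simpa [zero_pow hn] using this
  have h2 : ContinuousAt L 0 :=
    h.differentiableOn.continuousOn.continuousAt (Metric.ball_mem_nhds _ one_pos)
  have h3 := ((h2.tendsto.comp h1).div_const (n : ℂ)).cexp
  have h4 : Complex.exp (L 0 / n) = (Real.exp ((L 0).re / n) : ℝ) := by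
    rw [h0]; push_cast; simp
  rw [← h4]
  refine h3.congr' ?_
  filter_upwards [exteriorDisk_mem_cobounded] with z hz
  rw [rootMap, mul_div_cancel_left₀ _ (ne_zero_of_mem_exteriorDisk hz)]
  rfl

/-- Taking `n`-th powers and using injectivity of `φ` yields `zⁿ = wⁿ`. The exponential factors
depend only on this power, so they coincide and cancel. -/
theorem injOn_rootMap (h : IsLogRatio φ L) (hφ : InjOn φ exteriorDisk) {n : ℕ} (hn : n ≠ 0)
    (u : Circle) : InjOn (rootMap L n u) exteriorDisk := by
  intro z hz w hw hzw
  have hmem : ∀ x ∈ exteriorDisk, (u : ℂ)⁻¹ * x ^ n ∈ exteriorDisk := by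
    intro x hx
    simp only [exteriorDisk, mem_ofPred_eq, norm_mul, norm_inv, Circle.norm_coe, inv_one, one_mul,
      norm_pow]
    exact one_lt_pow₀ hx hn
  have h1 := congrArg (· ^ n) hzw
  simp only [h.rootMap_pow hn u hz, h.rootMap_pow hn u hw] at h1
  have h2 := mul_left_cancel₀ (inv_ne_zero u.coe_ne_zero)
    (hφ (hmem z hz) (hmem w hw) (mul_left_cancel₀ u.coe_ne_zero h1))
  rw [rootMap, rootMap, h2] at hzw
  exact mul_right_cancel₀ (Complex.exp_ne_zero _) hzw

theorem isKoebeTransform_rootMap (h : IsLogRatio φ L) {n : ℕ} (hn : n ≠ 0) (θ : Angles) :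
    IsKoebeTransform n (rotated φ θ) (rootMap L n (AddCircle.toCircle θ)) where
  differentiableOn := h.differentiableOn_rootMap hn _
  pow_eq z hz := by
    rw [h.rootMap_pow hn _ hz, rotated, AddCircle.toCircle_neg, Circle.coe_inv]
  normalized := ⟨_, Real.exp_pos _, h.tendsto_rootMap_div hn _⟩

theorem koebe_rotated (h : IsLogRatio φ L) {n : ℕ} (hn : n ≠ 0) (θ : Angles) :
    EqOn (koebe n (rotated φ θ)) (rootMap L n (AddCircle.toCircle θ)) exteriorDisk :=
  IsKoebeTransform.eqOn hn
    (Classical.epsilon_spec ⟨_, h.isKoebeTransform_rootMap hn θ⟩)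
    (h.isKoebeTransform_rootMap hn θ)
    fun _ hz => ne_zero_of_mem_exteriorDisk (h.mapsTo_rootMap hn _ hz)

theorem rotated_eq_rootMap (h : IsLogRatio φ L) (θ : Angles) {z : ℂ} (hz : z ∈ exteriorDisk) :
    rotated φ θ z = rootMap L 1 (AddCircle.toCircle θ) z := by
  have := h.rootMap_pow one_ne_zero (AddCircle.toCircle θ) hz
  rw [pow_one, pow_one] at this
  rw [this, rotated, AddCircle.toCircle_neg, Circle.coe_inv]

end IsLogRatio

/-! ### Finite compositions and estimates uniform in the angles -/

/-- The composition of the `m` root maps with exponents `k ^ n, …, k ^ (n + m - 1)`. -/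
noncomputable def rootChain (L : ℂ → ℂ) (k : ℕ) (u : ℕ → Circle) (n : ℕ) : ℕ → ℂ → ℂ
  | 0 => id
  | m + 1 => fun z => rootChain L k u n m (rootMap L (k ^ (n + m)) (u (n + m)) z)

theorem rootChain_succ (L : ℂ → ℂ) (k : ℕ) (u : ℕ → Circle) (n m : ℕ) (z : ℂ) :
    rootChain L k u n (m + 1) z =
      rootChain L k u n m (rootMap L (k ^ (n + m)) (u (n + m)) z) := rfl

theorem rootChain_add (L : ℂ → ℂ) (k : ℕ) (u : ℕ → Circle) (n m : ℕ) (z : ℂ) :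
    rootChain L k u 0 (n + m) z = rootChain L k u 0 n (rootChain L k u n m z) := by
  induction m generalizing z with
  | zero => rfl
  | succ m ih => rw [← add_assoc, rootChain_succ, ih, zero_add, rootChain_succ]

theorem norm_exp_sub_one_le_norm_mul_exp (s : ℂ) :
    ‖Complex.exp s - 1‖ ≤ ‖s‖ * Real.exp ‖s‖ := by
  simpa using Complex.norm_exp_sub_sum_le_norm_mul_exp s 1

namespace IsLogRatio

variable {φ L : ℂ → ℂ}

theorem exists_norm_le (h : IsLogRatio φ L) {r : ℝ} (hr : 1 < r) :
    ∃ M : ℝ, 0 ≤ M ∧ ∀ ζ : ℂ, ‖ζ‖ ≤ r⁻¹ → ‖L ζ‖ ≤ M := by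
  have hsub : Metric.closedBall (0 : ℂ) r⁻¹ ⊆ Metric.ball 0 1 :=
    Metric.closedBall_subset_ball (inv_lt_one_of_one_lt₀ hr)
  obtain ⟨M, hM⟩ := (isCompact_closedBall (0 : ℂ) r⁻¹).exists_bound_of_continuousOn
    (h.differentiableOn.continuousOn.mono hsub)
  exact ⟨max M 0, le_max_right _ _, fun ζ hζ =>
    (hM ζ (mem_closedBall_zero_iff.2 hζ)).trans (le_max_left _ _)⟩

section chain

variable {k : ℕ} (u : ℕ → Circle)

theorem norm_le_norm_rootChain (h : IsLogRatio φ L) (hk : k ≠ 0) (n m : ℕ) {z : ℂ}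
    (hz : z ∈ exteriorDisk) : ‖z‖ ≤ ‖rootChain L k u n m z‖ := by
  induction m generalizing z with
  | zero => exact le_rfl
  | succ m ih =>
    exact (h.norm_le_norm_rootMap (pow_ne_zero _ hk) _ hz).trans
      (ih (h.mapsTo_rootMap (pow_ne_zero _ hk) _ hz))

theorem differentiableOn_rootChain (h : IsLogRatio φ L) (hk : k ≠ 0) (n m : ℕ) :
    DifferentiableOn ℂ (rootChain L k u n m) exteriorDisk := by
  induction m with
  | zero => exact differentiableOn_id
  | succ m ih =>
    exact ih.comp (h.differentiableOn_rootMap (pow_ne_zero _ hk) _)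
      (h.mapsTo_rootMap (pow_ne_zero _ hk) _)

theorem injOn_rootChain (h : IsLogRatio φ L) (hφ : InjOn φ exteriorDisk) (hk : k ≠ 0) (n m : ℕ) :
    InjOn (rootChain L k u n m) exteriorDisk := by
  induction m with
  | zero => exact injOn_id _
  | succ m ih =>
    exact ih.comp (h.injOn_rootMap hφ (pow_ne_zero _ hk) _)
      (h.mapsTo_rootMap (pow_ne_zero _ hk) _)

theorem continuousOn_rootChain (h : IsLogRatio φ L) (hk : k ≠ 0) (n m : ℕ) :
    ContinuousOn (fun p : (ℕ → Circle) × ℂ => rootChain L k p.1 n m p.2)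
      (univ ×ˢ exteriorDisk) := by
  induction m with
  | zero => exact continuousOn_snd
  | succ m ih =>
    have h1 : ContinuousOn (fun p : (ℕ → Circle) × ℂ =>
        rootMap L (k ^ (n + m)) (p.1 (n + m)) p.2) (univ ×ˢ exteriorDisk) :=
      (h.continuousOn_rootMap (pow_ne_zero (n + m) hk)).comp
        (f := fun p : (ℕ → Circle) × ℂ => (p.1 (n + m), p.2)) (by fun_prop)
        fun p hp => ⟨mem_univ _, hp.2⟩
    exact ih.comp (continuousOn_fst.prodMk h1) fun p hp =>
      ⟨mem_univ _, h.mapsTo_rootMap (pow_ne_zero _ hk) _ hp.2⟩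

theorem exists_rootMap_eq_mul_exp (hk : 2 ≤ k) {r M : ℝ} (hr : 1 < r)
    (hM : ∀ ζ : ℂ, ‖ζ‖ ≤ r⁻¹ → ‖L ζ‖ ≤ M) (n : ℕ) (v : Circle) {z : ℂ} (hz : r ≤ ‖z‖) :
    ∃ s : ℂ, rootMap L (k ^ n) v z = z * Complex.exp s ∧ ‖s‖ ≤ M * (1 / 2) ^ n := by
  have hk0 : (k ^ n : ℕ) ≠ 0 := by positivity
  have hz1 : 1 ≤ ‖z‖ := hr.le.trans hz
  have hpow : r ≤ ‖z‖ ^ (k ^ n) := hz.trans (le_self_pow₀ hz1 hk0)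
  have h1 : ‖(v : ℂ) * (z ^ (k ^ n))⁻¹‖ ≤ r⁻¹ := by
    rw [norm_mul, Circle.norm_coe, one_mul, norm_inv, norm_pow]
    exact inv_anti₀ (by linarith) hpow
  refine ⟨_, rfl, ?_⟩
  have hM0 : 0 ≤ M := (norm_nonneg _).trans (hM _ h1)
  rw [norm_div, Complex.norm_natCast, div_eq_mul_inv]
  have h2 : (2 : ℝ) ^ n ≤ ((k ^ n : ℕ) : ℝ) := by
    exact_mod_cast Nat.pow_le_pow_left hk n
  have h3 : (((k ^ n : ℕ) : ℝ))⁻¹ ≤ (1 / 2) ^ n := by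
    rw [one_div, inv_pow]
    exact inv_anti₀ (by positivity) h2
  exact mul_le_mul (hM _ h1) h3 (by positivity) hM0

/-- Root maps do not decrease the norm, so all intermediate points stay in `‖z‖ ≥ r` and the
exponents add up. The bound is the exact partial geometric sum, which lets the induction close. -/
theorem exists_rootChain_eq_mul_exp (h : IsLogRatio φ L) (hk : 2 ≤ k) {r M : ℝ} (hr : 1 < r)
    (hM : ∀ ζ : ℂ, ‖ζ‖ ≤ r⁻¹ → ‖L ζ‖ ≤ M) (n m : ℕ) {z : ℂ} (hz : r ≤ ‖z‖) :
    ∃ s : ℂ, rootChain L k u n m z = z * Complex.exp s ∧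
      ‖s‖ ≤ 2 * M * ((1 / 2) ^ n - (1 / 2) ^ (n + m)) := by
  induction m generalizing z with
  | zero => exact ⟨0, by simp [rootChain], by simp⟩
  | succ m ih =>
    have hk0 : k ^ (n + m) ≠ 0 := pow_ne_zero _ (by omega)
    obtain ⟨s, hs, hsM⟩ := exists_rootMap_eq_mul_exp hk hr hM (n + m) (u (n + m)) hz
    have hz' : r ≤ ‖rootMap L (k ^ (n + m)) (u (n + m)) z‖ :=
      hz.trans (h.norm_le_norm_rootMap hk0 _ (hr.trans_le hz))
    obtain ⟨s', hs', hsM'⟩ := ih hz'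
    refine ⟨s + s', ?_, ?_⟩
    · rw [rootChain_succ, hs', hs, Complex.exp_add, mul_assoc]
    · refine (norm_add_le _ _).trans ((add_le_add hsM hsM').trans_eq ?_)
      rw [← add_assoc, pow_succ _ (n + m)]
      ring

theorem norm_rootChain_le (h : IsLogRatio φ L) (hk : 2 ≤ k) {r M : ℝ} (hr : 1 < r)
    (hM : ∀ ζ : ℂ, ‖ζ‖ ≤ r⁻¹ → ‖L ζ‖ ≤ M) (hM0 : 0 ≤ M) (m : ℕ) {z : ℂ} (hz : r ≤ ‖z‖) :
    ‖rootChain L k u 0 m z‖ ≤ ‖z‖ * Real.exp (2 * M) := by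
  obtain ⟨s, hs, hsM⟩ := h.exists_rootChain_eq_mul_exp u hk hr hM 0 m hz
  rw [hs, norm_mul]
  refine mul_le_mul_of_nonneg_left ((Complex.norm_exp_le_exp_norm s).trans ?_) (norm_nonneg _)
  refine Real.exp_le_exp.2 (hsM.trans ?_)
  have : (0 : ℝ) ≤ (1 / 2) ^ (0 + m) := by positivity
  rw [pow_zero]
  nlinarith

theorem norm_rootChain_sub_self_le (h : IsLogRatio φ L) (hk : 2 ≤ k) {r M : ℝ} (hr : 1 < r)
    (hM : ∀ ζ : ℂ, ‖ζ‖ ≤ r⁻¹ → ‖L ζ‖ ≤ M) (hM0 : 0 ≤ M) (n m : ℕ) {z : ℂ} (hz : r ≤ ‖z‖) :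
    ‖rootChain L k u n m z - z‖ ≤ ‖z‖ * (2 * M * Real.exp (2 * M)) * (1 / 2) ^ n := by
  obtain ⟨s, hs, hsM⟩ := h.exists_rootChain_eq_mul_exp u hk hr hM n m hz
  have h0 : (0 : ℝ) ≤ (1 / 2) ^ (n + m) := by positivity
  have h1 : (1 / 2 : ℝ) ^ n ≤ 1 := pow_le_one₀ (by norm_num) (by norm_num)
  have hs1 : ‖s‖ ≤ 2 * M * (1 / 2) ^ n := hsM.trans (by gcongr; linarith)
  have hs2 : ‖s‖ ≤ 2 * M := hs1.trans (mul_le_of_le_one_right (by positivity) h1)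
  rw [hs, show z * Complex.exp s - z = z * (Complex.exp s - 1) by ring, norm_mul]
  calc ‖z‖ * ‖Complex.exp s - 1‖ ≤ ‖z‖ * (‖s‖ * Real.exp ‖s‖) := by
        gcongr; exact norm_exp_sub_one_le_norm_mul_exp s
    _ ≤ ‖z‖ * ((2 * M * (1 / 2) ^ n) * Real.exp (2 * M)) := by gcongr
    _ = _ := by ring

/-- Equicontinuity of the compositions, in scale-invariant form. -/
theorem exists_dist_rootChain_le (h : IsLogRatio φ L) (hk : 2 ≤ k) {r : ℝ} (hr : 1 < r) :
    ∃ K : ℝ, 0 ≤ K ∧ ∀ (u : ℕ → Circle) (m : ℕ) (z w : ℂ), r ≤ ‖z‖ → r ≤ ‖w‖ →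
      dist (rootChain L k u 0 m w) (rootChain L k u 0 m z) ≤ K * dist w z := by
  -- The growth bound is taken on the larger region `‖x‖ ≥ (1 + r) / 2`, and `ρ` below is such that
  -- the disk of radius `ρ * ‖z‖` about any `z` with `‖z‖ ≥ r` stays in it.
  have hr1 : 1 < (1 + r) / 2 := by linarith
  obtain ⟨M, hM0, hM⟩ := h.exists_norm_le hr1
  set B := Real.exp (2 * M) with hB
  have hB0 : 0 < B := Real.exp_pos _
  set ρ := 1 - (1 + r) / 2 / r with hρ
  have hr0 : 0 < r := by linarith
  have hρ0 : 0 < ρ := by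
    rw [hρ, sub_pos, div_lt_one hr0]; linarith
  have hρ1 : ρ ≤ 1 := by
    have : 0 ≤ (1 + r) / 2 / r := by positivity
    linarith
  refine ⟨4 * B / ρ, by positivity, fun u m z w hz hw => ?_⟩
  have hz0 : 0 < ‖z‖ := hr0.trans_le hz
  have hbd : ∀ x : ℂ, (1 + r) / 2 ≤ ‖x‖ → ‖rootChain L k u 0 m x‖ ≤ ‖x‖ * B := fun x hx =>
    h.norm_rootChain_le u hk hr1 hM hM0 m hx
  have hzB := hbd z (by linarith)
  by_cases hwz : w ∈ Metric.ball z (ρ * ‖z‖)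
  · have hball : ∀ x ∈ Metric.ball z (ρ * ‖z‖), (1 + r) / 2 ≤ ‖x‖ ∧ ‖x‖ ≤ 2 * ‖z‖ := by
      intro x hx
      rw [mem_ball_iff_norm] at hx
      have h1 := norm_sub_norm_le z x
      rw [norm_sub_rev] at h1
      have h2 := norm_sub_norm_le x z
      have h3 : (1 + r) / 2 ≤ (1 + r) / 2 / r * ‖z‖ := by
        calc (1 + r) / 2 = (1 + r) / 2 / r * r := by field_simp
          _ ≤ _ := by gcongr
      have h4 : ρ * ‖z‖ = ‖z‖ - (1 + r) / 2 / r * ‖z‖ := by rw [hρ]; ring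
      refine ⟨by linarith, ?_⟩
      have : ρ * ‖z‖ ≤ ‖z‖ := mul_le_of_le_one_left hz0.le hρ1
      linarith
    have hmaps : MapsTo (rootChain L k u 0 m) (Metric.ball z (ρ * ‖z‖))
        (Metric.closedBall (rootChain L k u 0 m z) (4 * B * ‖z‖)) := by
      intro x hx
      rw [mem_closedBall_iff_norm]
      have h1 := hbd x (hball x hx).1
      have h2 : ‖x‖ * B ≤ 2 * ‖z‖ * B := by gcongr; exact (hball x hx).2
      have h3 : 0 ≤ ‖z‖ * B := by positivity
      refine (norm_sub_le _ _).trans ?_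
      linarith
    have hd : DifferentiableOn ℂ (rootChain L k u 0 m) (Metric.ball z (ρ * ‖z‖)) :=
      (h.differentiableOn_rootChain u (by omega) 0 m).mono fun x hx =>
        hr1.trans_le (hball x hx).1
    -- The Schwarz lemma on the disk gives the ratio of the radii as Lipschitz constant, and `‖z‖`
    -- cancels.
    refine (Complex.dist_le_div_mul_dist_of_mapsTo_ball hd hmaps hwz).trans_eq ?_
    rw [mul_div_mul_right _ _ hz0.ne']
  -- For distant points `dist w z ≥ ρ * ‖z‖`, so the growth bound alone suffices.
  · rw [Metric.mem_ball, not_lt] at hwz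
    have h1 := hbd w (by linarith)
    have h2 : ‖w‖ ≤ dist w z + ‖z‖ := by
      rw [dist_eq_norm]; linarith [norm_sub_norm_le w z]
    have h3 : ‖z‖ ≤ dist w z / ρ := by rw [le_div_iff₀ hρ0]; linarith
    have h4 : dist w z ≤ dist w z / ρ := by
      rw [le_div_iff₀ hρ0]; exact mul_le_of_le_one_right dist_nonneg hρ1
    calc dist (rootChain L k u 0 m w) (rootChain L k u 0 m z)
        ≤ ‖rootChain L k u 0 m w‖ + ‖rootChain L k u 0 m z‖ := by
          rw [dist_eq_norm]; exact norm_sub_le _ _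
      _ ≤ (‖w‖ + ‖z‖) * B := by linarith
      _ ≤ (4 * (dist w z / ρ)) * B := by
          have : 0 ≤ dist w z / ρ := by positivity
          gcongr; linarith
      _ = _ := by ring

/-- The extra factor is the innermost one: it moves `z` by `O(‖z‖ * 2⁻ᵐ)`, and the outer composition
is Lipschitz with a constant independent of `m` and `u`. -/
theorem exists_dist_rootChain_succ_le (h : IsLogRatio φ L) (hk : 2 ≤ k) {r : ℝ} (hr : 1 < r) :
    ∃ C : ℝ, 0 ≤ C ∧ ∀ (u : ℕ → Circle) (m : ℕ) (z : ℂ), r ≤ ‖z‖ →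
      dist (rootChain L k u 0 m z) (rootChain L k u 0 (m + 1) z) ≤ ‖z‖ * C * (1 / 2) ^ m := by
  obtain ⟨K, hK0, hK⟩ := h.exists_dist_rootChain_le hk hr
  obtain ⟨M, hM0, hM⟩ := h.exists_norm_le hr
  refine ⟨K * (2 * M * Real.exp (2 * M)), by positivity, fun u m z hz => ?_⟩
  have h1 := h.norm_rootChain_sub_self_le u hk hr hM hM0 m 1 hz
  have h2 := h.norm_le_norm_rootChain u (by omega : k ≠ 0) m 1 (z := z) (hr.trans_le hz)
  rw [rootChain_add, dist_comm]
  refine (hK u m z _ hz (hz.trans h2)).trans ?_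
  rw [dist_eq_norm]
  calc K * ‖rootChain L k u m 1 z - z‖
      ≤ K * (‖z‖ * (2 * M * Real.exp (2 * M)) * (1 / 2) ^ m) := by gcongr
    _ = _ := by ring

end chain

end IsLogRatio

/-! ### Convergence to the snowflake, which lies in `Σ'` -/

/-- The sequence of unimodular numbers `e^{iθ_n}`. -/
noncomputable def circleSeq (t : ℕ → Angles) (n : ℕ) : Circle := AddCircle.toCircle (t n)

theorem continuous_circleSeq : Continuous circleSeq :=
  continuous_pi fun n => AddCircle.continuous_toCircle.comp (continuous_apply n)

namespace IsLogRatio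

variable {φ L : ℂ → ℂ} {k : ℕ}

theorem snowflakeApprox_eq (h : IsLogRatio φ L) (hk : k ≠ 0) (t : ℕ → Angles) (n : ℕ) :
    EqOn (snowflakeApprox φ k t n) (rootChain L k (circleSeq t) 0 (n + 1)) exteriorDisk := by
  induction n with
  | zero =>
    intro z hz
    rw [rootChain_succ, zero_add, pow_zero]
    exact h.rotated_eq_rootMap _ hz
  | succ n ih =>
    intro z hz
    have hk0 : k ^ (n + 1) ≠ 0 := pow_ne_zero _ hk
    rw [rootChain_succ, zero_add]
    change snowflakeApprox φ k t n (koebe (k ^ (n + 1)) (rotated φ (t (n + 1))) z) = _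
    rw [h.koebe_rotated hk0 _ hz]
    exact ih (h.mapsTo_rootMap hk0 _ hz)

theorem tendsto_rootChain (h : IsLogRatio φ L) (hk : 2 ≤ k) (t : ℕ → Angles) {z : ℂ}
    (hz : z ∈ exteriorDisk) :
    Tendsto (fun n => rootChain L k (circleSeq t) 0 n z) atTop (𝓝 (snowflake φ k t z)) := by
  obtain ⟨C, hC0, hC⟩ := h.exists_dist_rootChain_succ_le hk hz
  obtain ⟨a, ha⟩ := cauchySeq_tendsto_of_complete
    (cauchySeq_of_le_geometric (1 / 2) (‖z‖ * C) (by norm_num)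
      fun m => hC (circleSeq t) m z le_rfl)
  have h1 : Tendsto (fun n => snowflakeApprox φ k t n z) atTop (𝓝 a) :=
    ((tendsto_add_atTop_iff_nat 1).2 ha).congr fun n =>
      (h.snowflakeApprox_eq (by omega) t n hz).symm
  rwa [show snowflake φ k t z = a from h1.limUnder_eq]

theorem exists_dist_rootChain_snowflake_le (h : IsLogRatio φ L) (hk : 2 ≤ k) {r : ℝ}
    (hr : 1 < r) :
    ∃ C : ℝ, 0 ≤ C ∧ ∀ (t : ℕ → Angles) (m : ℕ) (z : ℂ), r ≤ ‖z‖ →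
      dist (snowflake φ k t z) (rootChain L k (circleSeq t) 0 m z) ≤ ‖z‖ * C * (1 / 2) ^ m := by
  obtain ⟨C, hC0, hC⟩ := h.exists_dist_rootChain_succ_le hk hr
  refine ⟨2 * C, by positivity, fun t m z hz => ?_⟩
  rw [dist_comm]
  refine (dist_le_of_le_geometric_of_tendsto (1 / 2) (‖z‖ * C) (by norm_num)
    (fun m => hC (circleSeq t) m z hz) (h.tendsto_rootChain hk t (hr.trans_le hz)) m).trans_eq ?_
  ring

/-- The error bound does not involve the angles, so convergence is locally uniform jointly in angles
and point. The resulting joint continuity underlies all measurability statements. -/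
theorem tendstoLocallyUniformlyOn_rootChain (h : IsLogRatio φ L) (hk : 2 ≤ k) :
    TendstoLocallyUniformlyOn
      (fun n (p : (ℕ → Angles) × ℂ) => rootChain L k (circleSeq p.1) 0 n p.2)
      (fun p => snowflake φ k p.1 p.2) atTop (univ ×ˢ exteriorDisk) := by
  rw [Metric.tendstoLocallyUniformlyOn_iff]
  rintro ε hε ⟨t₀, z₀⟩ ⟨-, hz₀⟩
  have hz₁ : 1 < ‖z₀‖ := hz₀
  obtain ⟨C, hC0, hC⟩ := h.exists_dist_rootChain_snowflake_le hk
    (show 1 < (1 + ‖z₀‖) / 2 by linarith)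
  have hlim : Tendsto (fun m : ℕ => (‖z₀‖ + 1) * C * (1 / 2 : ℝ) ^ m) atTop (𝓝 0) := by
    simpa using (tendsto_pow_atTop_nhds_zero_of_lt_one (r := (1 / 2 : ℝ)) (by norm_num)
      (by norm_num)).const_mul ((‖z₀‖ + 1) * C)
  refine ⟨{p | (1 + ‖z₀‖) / 2 < ‖p.2‖ ∧ ‖p.2‖ < ‖z₀‖ + 1}, mem_nhdsWithin_of_mem_nhds ?_, ?_⟩
  · refine IsOpen.mem_nhds ?_ ⟨?_, ?_⟩
    · exact (isOpen_lt continuous_const (continuous_norm.comp continuous_snd)).inter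
        (isOpen_lt (continuous_norm.comp continuous_snd) continuous_const)
    · change (1 + ‖z₀‖) / 2 < ‖z₀‖
      linarith
    · change ‖z₀‖ < ‖z₀‖ + 1
      linarith
  · filter_upwards [hlim.eventually_lt_const hε] with m hm p hp
    refine (hC p.1 m p.2 hp.1.le).trans_lt (lt_of_le_of_lt ?_ hm)
    gcongr
    exact hp.2.le

theorem continuousOn_snowflake (h : IsLogRatio φ L) (hk : 2 ≤ k) :
    ContinuousOn (fun p : (ℕ → Angles) × ℂ => snowflake φ k p.1 p.2) (univ ×ˢ exteriorDisk) :=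
  (h.tendstoLocallyUniformlyOn_rootChain hk).continuousOn <| Frequently.of_forall fun n =>
    (h.continuousOn_rootChain (by omega) 0 n).comp
      (f := fun p : (ℕ → Angles) × ℂ => (circleSeq p.1, p.2))
      ((continuous_circleSeq.comp continuous_fst).prodMk continuous_snd).continuousOn
      fun _ hp => ⟨mem_univ _, hp.2⟩

theorem tendstoLocallyUniformlyOn_rootChain_apply (h : IsLogRatio φ L) (hk : 2 ≤ k)
    (t : ℕ → Angles) :
    TendstoLocallyUniformlyOn (rootChain L k (circleSeq t) 0) (snowflake φ k t) atTop
      exteriorDisk :=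
  (h.tendstoLocallyUniformlyOn_rootChain hk).comp (fun z => (t, z)) (fun _ hz => ⟨mem_univ _, hz⟩)
    (by fun_prop)

theorem tendstoLocallyUniformlyOn_snowflakeApprox (h : IsLogRatio φ L) (hk : 2 ≤ k)
    (t : ℕ → Angles) :
    TendstoLocallyUniformlyOn (snowflakeApprox φ k t) (snowflake φ k t) atTop exteriorDisk := by
  have h1 : TendstoLocallyUniformlyOn (fun n => rootChain L k (circleSeq t) 0 (n + 1))
      (snowflake φ k t) atTop exteriorDisk := fun v hv z hz => by
    obtain ⟨s, hs, hsv⟩ := h.tendstoLocallyUniformlyOn_rootChain_apply hk t v hv z hz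
    exact ⟨s, hs, (tendsto_add_atTop_nat 1).eventually hsv⟩
  exact h1.congr fun n z hz => (h.snowflakeApprox_eq (by omega) t n hz).symm

theorem norm_le_norm_snowflake (h : IsLogRatio φ L) (hk : 2 ≤ k) (t : ℕ → Angles) {z : ℂ}
    (hz : z ∈ exteriorDisk) : ‖z‖ ≤ ‖snowflake φ k t z‖ :=
  ge_of_tendsto' (h.tendsto_rootChain hk t hz).norm fun m =>
    h.norm_le_norm_rootChain _ (by omega) 0 m hz

/-- Subsequential limits of the tails split the snowflake as a finite composition followed by a
small perturbation of the identity. -/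
theorem exists_rootChain_eq_snowflake (h : IsLogRatio φ L) (hk : 2 ≤ k) (t : ℕ → Angles) {r M : ℝ}
    (hr : 1 < r) (hM : ∀ ζ : ℂ, ‖ζ‖ ≤ r⁻¹ → ‖L ζ‖ ≤ M) (hM0 : 0 ≤ M) (n : ℕ) {z : ℂ}
    (hz : r ≤ ‖z‖) :
    ∃ a ∈ exteriorDisk, rootChain L k (circleSeq t) 0 n a = snowflake φ k t z ∧
      ‖a - z‖ ≤ ‖z‖ * (2 * M * Real.exp (2 * M)) * (1 / 2) ^ n := by
  have hk0 : k ≠ 0 := by omega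
  have hz1 : z ∈ exteriorDisk := hr.trans_le hz
  -- All tail compositions at `z` lie in this compact subset of the exterior disk, so a
  -- subsequential limit is enough and convergence of the tails need not be shown.
  set K : Set ℂ := {a | ‖z‖ ≤ ‖a‖} ∩
    Metric.closedBall z (‖z‖ * (2 * M * Real.exp (2 * M)) * (1 / 2) ^ n) with hK
  have hKc : IsCompact K := (isCompact_closedBall _ _).inter_left
    (isClosed_le continuous_const continuous_norm)
  have hmem : ∀ m, rootChain L k (circleSeq t) n m z ∈ K := fun m =>
    ⟨h.norm_le_norm_rootChain _ hk0 n m hz1, mem_closedBall_iff_norm.2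
      (h.norm_rootChain_sub_self_le _ hk hr hM hM0 n m hz)⟩
  obtain ⟨a, haK, σ, hσ, ha⟩ := hKc.tendsto_subseq hmem
  have ha1 : a ∈ exteriorDisk := (show 1 < ‖z‖ from hz1).trans_le haK.1
  refine ⟨a, ha1, ?_, mem_closedBall_iff_norm.1 haK.2⟩
  have hcont : ContinuousAt (rootChain L k (circleSeq t) 0 n) a :=
    (h.differentiableOn_rootChain _ hk0 0 n).continuousOn.continuousAt
      (isOpen_exteriorDisk.mem_nhds ha1)
  have h1 : Tendsto (fun j => rootChain L k (circleSeq t) 0 (n + σ j) z) atTop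
      (𝓝 (rootChain L k (circleSeq t) 0 n a)) :=
    (hcont.tendsto.comp ha).congr fun j => (rootChain_add L k _ n (σ j) z).symm
  refine tendsto_nhds_unique h1 ((h.tendsto_rootChain hk t hz1).comp ?_)
  exact tendsto_atTop_mono (fun j => Nat.le_add_left _ _) hσ.tendsto_atTop

/-- If `f z = f w`, injectivity of the outer `n`-fold composition gives one point within `O(2⁻ⁿ)` of
both `z` and `w`. Letting `n → ∞` gives `z = w`. -/
theorem injOn_snowflake (h : IsLogRatio φ L) (hφ : InjOn φ exteriorDisk) (hk : 2 ≤ k)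
    (t : ℕ → Angles) : InjOn (snowflake φ k t) exteriorDisk := by
  intro z hz w hw hzw
  have hr : 1 < min ‖z‖ ‖w‖ := lt_min hz hw
  obtain ⟨M, hM0, hM⟩ := h.exists_norm_le hr
  have hbound : ∀ n : ℕ, dist z w ≤
      (‖z‖ + ‖w‖) * (2 * M * Real.exp (2 * M)) * (1 / 2) ^ n := by
    intro n
    obtain ⟨a, ha, haz, hda⟩ := h.exists_rootChain_eq_snowflake hk t hr hM hM0 n (min_le_left _ _)
    obtain ⟨b, hb, hbw, hdb⟩ := h.exists_rootChain_eq_snowflake hk t hr hM hM0 n (min_le_right _ _)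
    have hab : a = b := h.injOn_rootChain _ hφ (by omega : k ≠ 0) 0 n ha hb (by rw [haz, hbw, hzw])
    subst hab
    rw [← dist_eq_norm] at hda hdb
    have := dist_triangle_left z w a
    linarith
  have hlim : Tendsto (fun n : ℕ => (‖z‖ + ‖w‖) * (2 * M * Real.exp (2 * M)) * (1 / 2 : ℝ) ^ n)
      atTop (𝓝 0) := by
    simpa using (tendsto_pow_atTop_nhds_zero_of_lt_one (r := (1 / 2 : ℝ)) (by norm_num)
      (by norm_num)).const_mul ((‖z‖ + ‖w‖) * (2 * M * Real.exp (2 * M)))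
  exact dist_le_zero.1 (ge_of_tendsto' hlim hbound)

theorem tendsto_rootChain_div (h : IsLogRatio φ L) (hk : k ≠ 0) (u : ℕ → Circle) (m : ℕ) :
    Tendsto (fun z => rootChain L k u 0 m z / z) (Bornology.cobounded ℂ)
      (𝓝 (Real.exp ((L 0).re * ∑ j ∈ Finset.range m, (1 / (k : ℝ)) ^ j) : ℝ)) := by
  induction m with
  | zero =>
    simp only [Finset.range_zero, Finset.sum_empty, mul_zero, Real.exp_zero, Complex.ofReal_one]
    refine tendsto_const_nhds.congr' ?_
    filter_upwards [exteriorDisk_mem_cobounded] with z hz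
    exact (div_self (ne_zero_of_mem_exteriorDisk hz)).symm
  | succ m ih =>
    have hk0 : k ^ (0 + m) ≠ 0 := pow_ne_zero _ hk
    have h1 : Tendsto (rootMap L (k ^ (0 + m)) (u (0 + m))) (Bornology.cobounded ℂ)
        (Bornology.cobounded ℂ) := by
      rw [← tendsto_norm_atTop_iff_cobounded]
      refine tendsto_atTop_mono' _ ?_ tendsto_norm_cobounded_atTop
      filter_upwards [exteriorDisk_mem_cobounded] with z hz
      exact h.norm_le_norm_rootMap hk0 _ hz
    have h2 := (ih.comp h1).mul (h.tendsto_rootMap_div hk0 (u (0 + m)))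
    have h3 : ((Real.exp ((L 0).re * ∑ j ∈ Finset.range (m + 1), (1 / (k : ℝ)) ^ j) : ℝ) : ℂ) =
        (Real.exp ((L 0).re * ∑ j ∈ Finset.range m, (1 / (k : ℝ)) ^ j) : ℝ) *
          (Real.exp ((L 0).re / (k ^ (0 + m) : ℕ)) : ℝ) := by
      rw [← Complex.ofReal_mul, ← Real.exp_add, Finset.sum_range_succ, mul_add, zero_add,
        Nat.cast_pow, one_div, inv_pow, ← div_eq_mul_inv]
    rw [h3]
    refine h2.congr' ?_
    filter_upwards [exteriorDisk_mem_cobounded] with z hz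
    exact div_mul_div_cancel₀ (ne_zero_of_mem_exteriorDisk (h.mapsTo_rootMap hk0 _ hz))

/-- The derivatives at infinity multiply to `exp (Re L(0) * ∑ k⁻ʲ)`, a convergent product. The
relative error is `O(2⁻ᵐ)` uniformly on `‖z‖ ≥ 2`, so the limits in `m` and `z` may be interchanged.
-/
theorem normalizedAtInfinity_snowflake (h : IsLogRatio φ L) (hk : 2 ≤ k) (t : ℕ → Angles) :
    NormalizedAtInfinity (snowflake φ k t) := by
  have hsum := (hasSum_geometric_of_lt_one (r := 1 / (k : ℝ)) (by positivity) (by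
    rw [div_lt_one (by positivity)]; exact_mod_cast hk)).tendsto_sum_nat
  have hlim : Tendsto (fun m : ℕ =>
      ((Real.exp ((L 0).re * ∑ j ∈ Finset.range m, (1 / (k : ℝ)) ^ j) : ℝ) : ℂ)) atTop
      (𝓝 (Real.exp ((L 0).re * (1 - 1 / (k : ℝ))⁻¹) : ℝ)) :=
    (Complex.continuous_ofReal.tendsto _).comp
      ((Real.continuous_exp.tendsto _).comp (hsum.const_mul _))
  refine ⟨_, Real.exp_pos _, TendstoUniformlyOnFilter.tendsto_of_eventually_tendsto ?_
    (Eventually.of_forall fun m =>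
      h.tendsto_rootChain_div (by omega : k ≠ 0) (circleSeq t) m) hlim⟩
  obtain ⟨C, hC0, hC⟩ := h.exists_dist_rootChain_snowflake_le hk one_lt_two
  rw [Metric.tendstoUniformlyOnFilter_iff]
  intro ε hε
  have hlim0 : Tendsto (fun m : ℕ => C * (1 / 2 : ℝ) ^ m) atTop (𝓝 0) := by
    simpa using (tendsto_pow_atTop_nhds_zero_of_lt_one (r := (1 / 2 : ℝ)) (by norm_num)
      (by norm_num)).const_mul C
  have hev := (hlim0.eventually_lt_const hε).prod_mk
    ((tendsto_norm_cobounded_atTop (E := ℂ)).eventually_ge_atTop 2)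
  filter_upwards [hev] with p hp
  have hz0 : 0 < ‖p.2‖ := by linarith [hp.2]
  have h1 := hC t p.1 p.2 hp.2
  rw [dist_eq_norm] at h1
  rw [dist_eq_norm, ← sub_div, norm_div]
  refine lt_of_le_of_lt ?_ hp.1
  rw [div_le_iff₀ hz0]
  linarith

theorem sigmaPrime_snowflake (h : IsLogRatio φ L) (hφ : InjOn φ exteriorDisk) (hk : 2 ≤ k)
    (t : ℕ → Angles) : SigmaPrime (snowflake φ k t) where
  differentiableOn := (h.tendstoLocallyUniformlyOn_rootChain_apply hk t).differentiableOn
    (Eventually.of_forall fun m => h.differentiableOn_rootChain _ (by omega) 0 m)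
    isOpen_exteriorDisk
  injOn := h.injOn_snowflake hφ hk t
  mapsTo _ hz := lt_of_lt_of_le hz (h.norm_le_norm_snowflake hk t hz)
  normalized := h.normalizedAtInfinity_snowflake hk t

end IsLogRatio

/-! ### Inverses of injective holomorphic maps -/

section inverse

variable {f g : ℂ → ℂ} {U : Set ℂ}

/-- This is the open mapping alternative: an injective map is not locally constant. -/
theorem nhds_le_map_nhds_of_injOn (hU : IsOpen U) (hf : DifferentiableOn ℂ f U)
    (hinj : InjOn f U) {z : ℂ} (hz : z ∈ U) : 𝓝 (f z) ≤ map f (𝓝 z) := by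
  refine (hf.analyticAt (hU.mem_nhds hz)).eventually_constant_or_nhds_le_map_nhds.resolve_left ?_
  intro hconst
  have h1 : ∀ᶠ x in 𝓝[≠] z, x = z := by
    filter_upwards [nhdsWithin_le_nhds hconst, nhdsWithin_le_nhds (hU.mem_nhds hz)] with x hx hxU
    exact hinj hxU hz hx
  obtain ⟨x, hx, hxz⟩ := (h1.and self_mem_nhdsWithin).exists
  exact hxz hx

theorem isOpen_image_of_injOn (hU : IsOpen U) (hf : DifferentiableOn ℂ f U)
    (hinj : InjOn f U) : IsOpen (f '' U) := by
  rw [isOpen_iff_mem_nhds]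
  rintro _ ⟨z, hz, rfl⟩
  exact nhds_le_map_nhds_of_injOn hU hf hinj hz (image_mem_map (hU.mem_nhds hz))

theorem continuousAt_of_leftInvOn (hU : IsOpen U) (hf : DifferentiableOn ℂ f U)
    (hg : LeftInvOn g f U) {z : ℂ} (hz : z ∈ U) : ContinuousAt g (f z) := by
  rw [ContinuousAt, hg hz]
  have h1 : Tendsto g (map f (𝓝 z)) (𝓝 z) := by
    refine tendsto_map'_iff.2 (tendsto_id.congr' ?_)
    filter_upwards [hU.mem_nhds hz] with x hx
    exact (hg hx).symm
  exact h1.mono_left (nhds_le_map_nhds_of_injOn hU hf hg.injOn hz)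

theorem eventually_rightInv_of_leftInvOn (hU : IsOpen U) (hf : DifferentiableOn ℂ f U)
    (hg : LeftInvOn g f U) {z : ℂ} (hz : z ∈ U) : ∀ᶠ y in 𝓝 (f z), f (g y) = y := by
  filter_upwards [(isOpen_image_of_injOn hU hf hg.injOn).mem_nhds (mem_image_of_mem f hz)]
  rintro _ ⟨x, hx, rfl⟩
  rw [hg hx]

/-- The inverse of an injective holomorphic function is holomorphic. -/
theorem differentiableAt_of_leftInvOn (hU : IsOpen U) (hf : DifferentiableOn ℂ f U)
    (hg : LeftInvOn g f U) {z : ℂ} (hz : z ∈ U) : DifferentiableAt ℂ g (f z) := by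
  have key : ∀ x ∈ U, deriv f x ≠ 0 → DifferentiableAt ℂ g (f x) := by
    intro x hx hd
    refine (HasDerivAt.of_local_left_inverse (continuousAt_of_leftInvOn hU hf hg hx) ?_ hd
      (eventually_rightInv_of_leftInvOn hU hf hg hx)).differentiableAt
    rw [hg hx]
    exact (hf.differentiableAt (hU.mem_nhds hx)).hasDerivAt
  have hcont := continuousAt_of_leftInvOn hU hf hg hz
  -- Zeros of `f'` are isolated, since otherwise `f` would be constant near `z`. The inverse is thus
  -- holomorphic on a punctured neighbourhood of `f z` and continuous at `f z`, so the singularity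
  -- is removable; nonvanishing of `f'` at `z` itself is not needed.
  have hd : ∀ᶠ x in 𝓝[≠] z, deriv f x ≠ 0 := by
    refine ((hf.analyticAt (hU.mem_nhds hz)).deriv.eventually_eq_zero_or_eventually_ne_zero
      ).resolve_left fun h0 => ?_
    obtain ⟨ε, hε, hball⟩ := Metric.eventually_nhds_iff_ball.1
      (h0.and (hU.eventually_mem hz))
    have h1 : ∀ x ∈ Metric.ball z ε, x = z := fun x hx =>
      hg.injOn (hball x hx).2 hz <| Metric.isOpen_ball.is_const_of_deriv_eq_zero
        (convex_ball z ε).isPreconnected (hf.mono fun y hy => (hball y hy).2)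
        (fun y hy => (hball y hy).1) hx (Metric.mem_ball_self hε)
    have h2 : ∀ᶠ x in 𝓝[≠] z, x = z :=
      nhdsWithin_le_nhds (Filter.mem_of_superset (Metric.ball_mem_nhds z hε) h1)
    obtain ⟨x, hx, hxz⟩ := (h2.and self_mem_nhdsWithin).exists
    exact hxz hx
  refine (Complex.analyticAt_of_differentiable_on_punctured_nhds_of_continuousAt ?_
    hcont).differentiableAt
  have hright := eventually_rightInv_of_leftInvOn hU hf hg hz
  have htend : Tendsto g (𝓝[≠] (f z)) (𝓝[≠] z) := by
    refine tendsto_nhdsWithin_iff.2 ⟨?_, ?_⟩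
    · have := hcont.tendsto
      rw [hg hz] at this
      exact this.mono_left nhdsWithin_le_nhds
    · filter_upwards [nhdsWithin_le_nhds hright, self_mem_nhdsWithin] with y hy hne hgy
      exact hne (by rw [mem_singleton_iff, ← hy, hgy])
  filter_upwards [htend.eventually hd, nhdsWithin_le_nhds hright,
    htend.eventually (nhdsWithin_le_nhds (hU.mem_nhds hz))] with y h1 h2 h3
  rw [← h2]
  exact key _ h3 h1

end inverse

/-! ### Measurability in the angles -/

section measurability

variable {X : Type*} [TopologicalSpace X]

/-- The set is the projection of a closed set along a compact factor. -/
theorem isClosed_setOf_exists_mem_compact {F : X × ℂ → ℂ} {K : Set ℂ} (hK : IsCompact K)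
    (hF : ContinuousOn F (univ ×ˢ K)) (w : ℂ) : IsClosed {t | ∃ z ∈ K, F (t, z) = w} := by
  have := isCompact_iff_compactSpace.1 hK
  have hc : Continuous fun p : X × K => F (p.1, p.2) :=
    hF.comp_continuous (by fun_prop) fun p => ⟨mem_univ _, p.2.2⟩
  convert! isClosedMap_fst_of_compactSpace (X := X) (Y := K) _
    ((isClosed_singleton (x := w)).preimage hc) using 1
  ext t
  simp

theorem measurableSet_setOf_exists_mem [MeasurableSpace X] [OpensMeasurableSpace X]
    {F : X × ℂ → ℂ} {U : Set ℂ} (hU : IsOpen U)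
    (hF : ContinuousOn F (univ ×ˢ U)) {C : Set ℂ} (hC : IsClosed C) (w : ℂ) :
    MeasurableSet {t | ∃ z ∈ U ∩ C, F (t, z) = w} := by
  obtain ⟨T, hTc, hTU, hT, -⟩ := hU.exists_iUnion_isClosed
  -- An open set is a countable union of closed sets; intersecting with balls makes the pieces
  -- compact.
  have h : {t | ∃ z ∈ U ∩ C, F (t, z) = w} =
      ⋃ n : ℕ, ⋃ m : ℕ, {t | ∃ z ∈ Metric.closedBall 0 m ∩ (T n ∩ C), F (t, z) = w} := by
    ext t
    simp only [mem_iUnion, mem_ofPred_eq]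
    constructor
    · rintro ⟨z, ⟨hzU, hzC⟩, hz⟩
      rw [← hT] at hzU
      obtain ⟨n, hn⟩ := mem_iUnion.1 hzU
      obtain ⟨m, hm⟩ := exists_nat_ge ‖z‖
      exact ⟨n, m, z, ⟨mem_closedBall_zero_iff.2 hm, hn, hzC⟩, hz⟩
    · rintro ⟨n, m, z, ⟨-, hn, hzC⟩, hz⟩
      exact ⟨z, ⟨hTU n hn, hzC⟩, hz⟩
  rw [h]
  refine MeasurableSet.iUnion fun n => MeasurableSet.iUnion fun m => IsClosed.measurableSet ?_
  refine isClosed_setOf_exists_mem_compact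
    ((isCompact_closedBall _ _).inter_right ((hTc n).inter hC)) (hF.mono ?_) w
  exact prod_mono_right fun z hz => hTU n hz.2.1

end measurability

theorem tendsto_nat_mul_sub_of_differentiableAt {f : ℂ → ℂ} {z : ℂ}
    (hf : DifferentiableAt ℂ f z) :
    Tendsto (fun n : ℕ => (n : ℂ) * (f (z + (n : ℂ)⁻¹) - f z)) atTop (𝓝 (deriv f z)) := by
  have h := hf.hasDerivAt.tendsto_slope_zero
  have h2 : Tendsto (fun n : ℕ => (n : ℂ)⁻¹) atTop (𝓝[≠] 0) := by
    refine tendsto_nhdsWithin_iff.2 ⟨tendsto_inv_atTop_nhds_zero_nat (𝕜 := ℂ), ?_⟩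
    filter_upwards [eventually_ne_atTop 0] with n hn
    simpa using hn
  refine (h.comp h2).congr fun n => ?_
  simp

section inverseSnowflake

variable {φ : ℂ → ℂ} {k : ℕ} {t : ℕ → Angles}

theorem inverseSnowflake_apply (hf : SigmaPrime (snowflake φ k t)) :
    LeftInvOn (inverseSnowflake φ k t) (snowflake φ k t) exteriorDisk := by
  intro z hz
  rw [inverseSnowflake, if_pos (mem_image_of_mem _ hz)]
  exact hf.injOn.leftInvOn_invFunOn hz

theorem inverseSnowflake_of_notMem {w : ℂ} (hw : w ∉ snowflake φ k t '' exteriorDisk) :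
    inverseSnowflake φ k t w = 0 := by
  rw [inverseSnowflake, if_neg hw]

theorem mem_image_iff_inverseSnowflake_ne_zero (hf : SigmaPrime (snowflake φ k t)) {w : ℂ} :
    w ∈ snowflake φ k t '' exteriorDisk ↔ inverseSnowflake φ k t w ≠ 0 := by
  refine ⟨?_, fun h => by_contra fun h' => h (inverseSnowflake_of_notMem h')⟩
  rintro ⟨z, hz, rfl⟩
  rw [inverseSnowflake_apply hf hz]
  exact ne_zero_of_mem_exteriorDisk hz

theorem inverseSnowflake_eq_iff (hf : SigmaPrime (snowflake φ k t)) {w z : ℂ} (hz : z ≠ 0) :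
    inverseSnowflake φ k t w = z ↔ z ∈ exteriorDisk ∧ snowflake φ k t z = w := by
  constructor
  · rintro rfl
    obtain ⟨x, hx, rfl⟩ := (mem_image_iff_inverseSnowflake_ne_zero hf).2 hz
    rw [inverseSnowflake_apply hf hx]
    exact ⟨hx, rfl⟩
  · rintro ⟨hz, rfl⟩
    exact inverseSnowflake_apply hf hz

theorem differentiableAt_inverseSnowflake (hf : SigmaPrime (snowflake φ k t)) {w : ℂ}
    (hw : inverseSnowflake φ k t w ≠ 0) : DifferentiableAt ℂ (inverseSnowflake φ k t) w := by
  obtain ⟨z, hz, rfl⟩ := (mem_image_iff_inverseSnowflake_ne_zero hf).2 hw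
  exact differentiableAt_of_leftInvOn isOpen_exteriorDisk hf.differentiableOn
    (inverseSnowflake_apply hf) hz

/-- The values of `g` are 0 or of norm greater than 1. Differentiability at a zero of `g` therefore
makes `g` vanish nearby; otherwise `deriv` takes its default value 0. -/
theorem deriv_inverseSnowflake_eq_zero (hf : SigmaPrime (snowflake φ k t)) {w : ℂ}
    (hw : inverseSnowflake φ k t w = 0) : deriv (inverseSnowflake φ k t) w = 0 := by
  by_cases hd : DifferentiableAt ℂ (inverseSnowflake φ k t) w
  · have h1 : ∀ᶠ y in 𝓝 w, ‖inverseSnowflake φ k t y‖ < 1 :=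
      hd.continuousAt.norm.eventually_lt_const (by simp [hw])
    have h2 : inverseSnowflake φ k t =ᶠ[𝓝 w] fun _ => 0 := by
      filter_upwards [h1] with y hy
      by_contra h0
      have h3 : 1 < ‖inverseSnowflake φ k t y‖ := ((inverseSnowflake_eq_iff hf h0).1 rfl).1
      exact lt_asymm hy h3
    rw [h2.deriv_eq, deriv_const]
  · exact deriv_zero_of_not_differentiableAt hd

end inverseSnowflake

section measurableSnowflake

variable {φ : ℂ → ℂ} {k : ℕ}

theorem measurable_snowflake
    (hc : ContinuousOn (fun p : (ℕ → Angles) × ℂ => snowflake φ k p.1 p.2) (univ ×ˢ exteriorDisk))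
    {z : ℂ} (hz : z ∈ exteriorDisk) : Measurable fun t => snowflake φ k t z :=
  (hc.comp_continuous (f := fun t : ℕ → Angles => (t, z)) (by fun_prop)
    fun _ => ⟨mem_univ _, hz⟩).measurable

theorem measurable_deriv_snowflake (hf : ∀ t, SigmaPrime (snowflake φ k t))
    (hc : ContinuousOn (fun p : (ℕ → Angles) × ℂ => snowflake φ k p.1 p.2) (univ ×ˢ exteriorDisk))
    {z : ℂ} (hz : z ∈ exteriorDisk) : Measurable fun t => deriv (snowflake φ k t) z := by
  have hlim : Tendsto (fun n : ℕ => z + (n : ℂ)⁻¹) atTop (𝓝 z) := by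
    simpa using (tendsto_inv_atTop_nhds_zero_nat (𝕜 := ℂ)).const_add z
  -- The index is shifted by `N` so that every difference quotient uses points of the exterior disk,
  -- where measurability is known.
  obtain ⟨N, hN⟩ := eventually_atTop.1 (hlim.eventually (isOpen_exteriorDisk.mem_nhds hz))
  refine measurable_of_tendsto_metrizable (f := fun (n : ℕ) (t : ℕ → Angles) =>
    ((n + N : ℕ) : ℂ) * (snowflake φ k t (z + ((n + N : ℕ) : ℂ)⁻¹) - snowflake φ k t z)) ?_ ?_
  · exact fun n => ((measurable_snowflake hc (hN _ (Nat.le_add_left _ _))).sub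
      (measurable_snowflake hc hz)).const_mul _
  · refine tendsto_pi_nhds.2 fun t => ?_
    exact (tendsto_nat_mul_sub_of_differentiableAt ((hf t).differentiableOn.differentiableAt
      (isOpen_exteriorDisk.mem_nhds hz))).comp (tendsto_add_atTop_nat N)

theorem measurable_inverseSnowflake (hf : ∀ t, SigmaPrime (snowflake φ k t))
    (hc : ContinuousOn (fun p : (ℕ → Angles) × ℂ => snowflake φ k p.1 p.2) (univ ×ˢ exteriorDisk))
    (w : ℂ) : Measurable fun t => inverseSnowflake φ k t w := by
  refine measurable_of_isClosed fun C hC => ?_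
  have hA : ∀ C : Set ℂ, IsClosed C →
      MeasurableSet {t | ∃ z ∈ exteriorDisk ∩ C, snowflake φ k t z = w} := fun C hC =>
    measurableSet_setOf_exists_mem isOpen_exteriorDisk hc hC w
  -- Either `w` has a preimage in `C`, or it has none and the default value 0 lies in `C`.
  have h : (fun t => inverseSnowflake φ k t w) ⁻¹' C =
      {t | ∃ z ∈ exteriorDisk ∩ C, snowflake φ k t z = w} ∪
        ({t | ∃ z ∈ exteriorDisk ∩ univ, snowflake φ k t z = w}ᶜ ∩ {_t | (0 : ℂ) ∈ C}) := by
    ext t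
    by_cases hw : w ∈ snowflake φ k t '' exteriorDisk
    · obtain ⟨z, hz, rfl⟩ := hw
      rw [mem_preimage, inverseSnowflake_apply (hf t) hz]
      constructor
      · exact fun hzC => Or.inl ⟨z, ⟨hz, hzC⟩, rfl⟩
      · rintro (⟨x, ⟨hx, hxC⟩, hxz⟩ | ⟨h1, -⟩)
        · rwa [← (hf t).injOn hx hz hxz]
        · exact absurd ⟨z, ⟨hz, mem_univ _⟩, rfl⟩ h1
    · rw [mem_preimage, inverseSnowflake_of_notMem hw]
      constructor
      · rintro h0
        exact Or.inr ⟨fun ⟨z, hz, hzw⟩ => hw ⟨z, hz.1, hzw⟩, h0⟩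
      · rintro (⟨x, ⟨hx, -⟩, hxz⟩ | ⟨-, h0⟩)
        · exact absurd ⟨x, hx, hxz⟩ hw
        · exact h0
  rw [h]
  exact (hA C hC).union ((hA univ isClosed_univ).compl.inter (MeasurableSet.const _))

theorem measurable_deriv_inverseSnowflake (hf : ∀ t, SigmaPrime (snowflake φ k t))
    (hc : ContinuousOn (fun p : (ℕ → Angles) × ℂ => snowflake φ k p.1 p.2) (univ ×ˢ exteriorDisk))
    (w : ℂ) : Measurable fun t => deriv (inverseSnowflake φ k t) w := by
  classical
  have hg := measurable_inverseSnowflake hf hc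
  -- On `S` the difference quotients need not converge, so they are replaced there by 0, the value
  -- of the derivative.
  refine measurable_of_tendsto_metrizable (f := fun (n : ℕ) (t : ℕ → Angles) =>
    if inverseSnowflake φ k t w = 0 then 0 else
      (n : ℂ) * (inverseSnowflake φ k t (w + (n : ℂ)⁻¹) - inverseSnowflake φ k t w)) ?_ ?_
  · exact fun n => Measurable.ite (hg w (measurableSet_singleton 0)) measurable_const
      (((hg _).sub (hg w)).const_mul _)
  · refine tendsto_pi_nhds.2 fun t => ?_
    by_cases hw : inverseSnowflake φ k t w = 0
    · simp only [hw, if_true, deriv_inverseSnowflake_eq_zero (hf t) hw]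
      exact tendsto_const_nhds
    · simp only [hw, if_false]
      exact tendsto_nat_mul_sub_of_differentiableAt (differentiableAt_inverseSnowflake (hf t) hw)

end measurableSnowflake

/-! ### Rotating the snowflake by shifting the angles -/

/-- The sequence of rotations that turns the snowflake of `t` by the angle `α`. -/
noncomputable def shiftAngles (k : ℕ) (α : Angles) (t : ℕ → Angles) (n : ℕ) : Angles := t n + k ^ n • α

theorem circleSeq_shiftAngles (k : ℕ) (α : Angles) (t : ℕ → Angles) (n : ℕ) :
    circleSeq (shiftAngles k α t) n = circleSeq t n * AddCircle.toCircle α ^ k ^ n := by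
  rw [circleSeq, shiftAngles, AddCircle.toCircle_add, AddCircle.toCircle_nsmul, circleSeq]

/-- The factor `vⁿ` cancels against `(v * z)ⁿ` in the argument of `L`, leaving only the outer factor
`v`. -/
theorem rootMap_mul_pow (L : ℂ → ℂ) (n : ℕ) (u v : Circle) (z : ℂ) :
    rootMap L n (u * v ^ n) (v * z) = v * rootMap L n u z := by
  have h : ((u * v ^ n : Circle) : ℂ) * ((v * z) ^ n)⁻¹ = u * (z ^ n)⁻¹ := by
    rw [Circle.coe_mul, Circle.coe_pow, mul_pow, mul_inv, mul_assoc,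
      mul_inv_cancel_left₀ (pow_ne_zero n v.coe_ne_zero)]
  rw [rootMap, h, rootMap, mul_assoc]

/-- The shift `k^j • α` at level `j` supplies exactly the phase `v^(k^j)` required there, so the
same rotation `v` passes through every factor. -/
theorem rootChain_shiftAngles (L : ℂ → ℂ) (k : ℕ) (α : Angles) (t : ℕ → Angles) (n m : ℕ) (z : ℂ) :
    rootChain L k (circleSeq (shiftAngles k α t)) n m (AddCircle.toCircle α * z) =
      AddCircle.toCircle α * rootChain L k (circleSeq t) n m z := by
  induction m generalizing z with
  | zero => rfl
  | succ m ih =>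
    rw [rootChain_succ, circleSeq_shiftAngles, rootMap_mul_pow, ih, rootChain_succ]

theorem circle_mul_mem_exteriorDisk (u : Circle) {z : ℂ} :
    (u : ℂ) * z ∈ exteriorDisk ↔ z ∈ exteriorDisk := by
  simp only [exteriorDisk, mem_ofPred_eq, norm_mul, Circle.norm_coe, one_mul]

section rotation

variable {φ L : ℂ → ℂ} {k : ℕ}

theorem IsLogRatio.snowflake_shiftAngles (h : IsLogRatio φ L) (hk : 2 ≤ k) (α : Angles)
    (t : ℕ → Angles) {z : ℂ} (hz : z ∈ exteriorDisk) :
    snowflake φ k (shiftAngles k α t) (AddCircle.toCircle α * z) =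
      AddCircle.toCircle α * snowflake φ k t z := by
  refine tendsto_nhds_unique
    (h.tendsto_rootChain hk _ ((circle_mul_mem_exteriorDisk _).2 hz)) ?_
  exact ((h.tendsto_rootChain hk t hz).const_mul _).congr fun n =>
    (rootChain_shiftAngles L k α t 0 n z).symm

theorem IsLogRatio.norm_deriv_snowflake_shiftAngles (h : IsLogRatio φ L) (hk : 2 ≤ k) (α : Angles)
    (t : ℕ → Angles) {z : ℂ} (hz : z ∈ exteriorDisk) :
    ‖deriv (snowflake φ k (shiftAngles k α t)) (AddCircle.toCircle α * z)‖ =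
      ‖deriv (snowflake φ k t) z‖ := by
  have h1 : (fun y => snowflake φ k (shiftAngles k α t) (AddCircle.toCircle α * y)) =ᶠ[𝓝 z]
      fun y => (AddCircle.toCircle α : ℂ) * snowflake φ k t y := by
    filter_upwards [isOpen_exteriorDisk.mem_nhds hz] with y hy
    exact h.snowflake_shiftAngles hk α t hy
  have h2 := h1.deriv_eq
  rw [deriv_comp_mul_left, deriv_const_mul_field] at h2
  simpa [norm_smul] using congrArg norm h2

theorem IsLogRatio.inverseSnowflake_shiftAngles (h : IsLogRatio φ L) (hφ : InjOn φ exteriorDisk)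
    (hk : 2 ≤ k) (α : Angles) (t : ℕ → Angles) (w : ℂ) :
    inverseSnowflake φ k (shiftAngles k α t) (AddCircle.toCircle α * w) =
      AddCircle.toCircle α * inverseSnowflake φ k t w := by
  have hf := h.sigmaPrime_snowflake hφ hk
  set v : Circle := AddCircle.toCircle α with hv
  by_cases h0 : inverseSnowflake φ k t w = 0
  · rw [h0, mul_zero]
    by_contra h1
    obtain ⟨hx, hxw⟩ := (inverseSnowflake_eq_iff (hf _) h1).1 rfl
    set x := inverseSnowflake φ k (shiftAngles k α t) (v * w) with hxdef
    -- Rotating the supposed preimage of `v * w` back by `v⁻¹` gives a preimage of `w`,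
    -- contradicting `g w = 0`.
    have hx' : ((v⁻¹ : Circle) : ℂ) * x ∈ exteriorDisk := (circle_mul_mem_exteriorDisk _).2 hx
    have h2 := h.snowflake_shiftAngles hk α t hx'
    rw [← hv, Circle.coe_inv, mul_inv_cancel_left₀ v.coe_ne_zero, hxw, ← Circle.coe_inv] at h2
    exact (mem_image_iff_inverseSnowflake_ne_zero (hf t)).1
      ⟨_, hx', (mul_left_cancel₀ v.coe_ne_zero h2).symm⟩ h0
  · obtain ⟨hx, hxw⟩ := (inverseSnowflake_eq_iff (hf _) h0).1 rfl
    rw [inverseSnowflake_eq_iff (hf _) (mul_ne_zero v.coe_ne_zero h0), circle_mul_mem_exteriorDisk,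
      h.snowflake_shiftAngles hk α t hx, hxw]
    exact ⟨hx, rfl⟩

theorem IsLogRatio.norm_deriv_inverseSnowflake_shiftAngles (h : IsLogRatio φ L)
    (hφ : InjOn φ exteriorDisk) (hk : 2 ≤ k) (α : Angles) (t : ℕ → Angles) (w : ℂ) :
    ‖deriv (inverseSnowflake φ k (shiftAngles k α t)) (AddCircle.toCircle α * w)‖ =
      ‖deriv (inverseSnowflake φ k t) w‖ := by
  have h1 : (fun y => inverseSnowflake φ k (shiftAngles k α t) (AddCircle.toCircle α * y)) =
      fun y => (AddCircle.toCircle α : ℂ) * inverseSnowflake φ k t y :=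
    funext fun y => h.inverseSnowflake_shiftAngles hφ hk α t y
  have h2 := congrArg (fun F => deriv F w) h1
  simp only [deriv_const_mul_field] at h2
  rw [deriv_comp_mul_left] at h2
  simpa [norm_smul] using congrArg norm h2

end rotation

/-! ### Invariance of the law and conclusion -/

instance : IsProbabilityMeasure uniformAngle := by
  unfold uniformAngle
  infer_instance

instance : uniformAngle.IsAddRightInvariant := by
  unfold uniformAngle
  infer_instance

/-- Deterministic rotations do not change the law of a sequence of independent uniform angles. -/
theorem identDistrib_add_const {Ω : Type*} [MeasurableSpace Ω] {P : Measure Ω}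
    [IsProbabilityMeasure P] {θ : ℕ → Ω → Angles} (hlaw : ∀ n, HasLaw (θ n) uniformAngle P)
    (hindep : iIndepFun θ P) (c : ℕ → Angles) :
    IdentDistrib (fun x n => θ n x) (fun x n => θ n x + c n) P P := by
  have hm : ∀ n, AEMeasurable (θ n) P := fun n => (hlaw n).aemeasurable
  have hm' : ∀ n, AEMeasurable (fun x => θ n x + c n) P := fun n => (hm n).add_const _
  have hindep' : iIndepFun (fun n x => θ n x + c n) P :=
    hindep.comp (fun n a => a + c n) fun n => measurable_add_const (c n)
  refine ⟨aemeasurable_pi_iff.2 hm, aemeasurable_pi_iff.2 hm', ?_⟩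
  -- Independence makes both joint laws product measures, so it suffices that each uniform factor is
  -- translation invariant.
  rw [(iIndepFun_iff_map_fun_eq_infinitePi_map₀' hm).1 hindep,
    (iIndepFun_iff_map_fun_eq_infinitePi_map₀' hm').1 hindep']
  congr 1
  funext n
  have h : P.map (fun x => θ n x + c n) = (P.map (θ n)).map (· + c n) :=
    (AEMeasurable.map_map_of_aemeasurable (measurable_add_const (c n)).aemeasurable (hm n)).symm
  rw [h, (hlaw n).map_eq, map_add_right_eq_self]

theorem exists_toCircle_mul_eq {z w : ℂ} (h : ‖z‖ = ‖w‖) :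
    ∃ α : Angles, w = AddCircle.toCircle α * z := by
  by_cases hz : z = 0
  · subst hz
    exact ⟨0, by rw [mul_zero, ← norm_eq_zero, ← h, norm_zero]⟩
  · have hmem : w / z ∈ Submonoid.unitSphere ℂ := by
      refine mem_sphere_zero_iff_norm.2 ?_
      rw [norm_div, ← h, div_self (norm_ne_zero_iff.2 hz)]
    obtain ⟨α, hα⟩ := (AddCircle.homeomorphCircle Real.two_pi_pos.ne').surjective ⟨w / z, hmem⟩
    rw [AddCircle.homeomorphCircle_apply] at hα
    exact ⟨α, by rw [hα]; exact (div_mul_cancel₀ w hz).symm⟩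

theorem toCircle_coe_angle (ω : ℝ) :
    (AddCircle.toCircle (ω : Angles) : ℂ) = Complex.exp (Complex.I * ω) := by
  rw [AddCircle.toCircle_apply_mk, div_self Real.two_pi_pos.ne', one_mul, Circle.coe_exp, mul_comm]

theorem mainTheorem3 (φ : ℂ → ℂ) (hφ : SigmaPrime φ) (k : ℕ) (hk : 2 ≤ k)
    {Ω : Type*} [MeasurableSpace Ω] (P : Measure Ω) [IsProbabilityMeasure P]
    (θ : ℕ → Ω → Angles) (hlaw : ∀ n, HasLaw (θ n) uniformAngle P) (hindep : iIndepFun θ P) :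
    -- the snowflake is well defined for every sequence of rotations
    (∀ t : ℕ → Angles, SigmaPrime (snowflake φ k t) ∧
      TendstoLocallyUniformlyOn (snowflakeApprox φ k t) (snowflake φ k t) atTop exteriorDisk) ∧
    -- rotational invariance of `g`, as a random function
    (∀ ω : ℝ, IdentDistrib
      (fun x => fun z : ℂ => inverseSnowflake φ k (fun n => θ n x) z)
      (fun x => fun z : ℂ => Complex.exp (Complex.I * ω) *
        inverseSnowflake φ k (fun n => θ n x) (Complex.exp (-(Complex.I * ω)) * z)) P P) ∧
    -- the laws of `|g(z)|` and `|g'(z)|` depend only on `|z|`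
    (∀ z w : ℂ, ‖z‖ = ‖w‖ →
      IdentDistrib (fun x => ‖inverseSnowflake φ k (fun n => θ n x) z‖)
        (fun x => ‖inverseSnowflake φ k (fun n => θ n x) w‖) P P ∧
      IdentDistrib (fun x => ‖deriv (inverseSnowflake φ k (fun n => θ n x)) z‖)
        (fun x => ‖deriv (inverseSnowflake φ k (fun n => θ n x)) w‖) P P) ∧
    -- the laws of `|f(z)|` and `|f'(z)|` depend only on `|z|`
    (∀ z w : ℂ, 1 < ‖z‖ → ‖z‖ = ‖w‖ →
      IdentDistrib (fun x => ‖snowflake φ k (fun n => θ n x) z‖)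
        (fun x => ‖snowflake φ k (fun n => θ n x) w‖) P P ∧
      IdentDistrib (fun x => ‖deriv (snowflake φ k (fun n => θ n x)) z‖)
        (fun x => ‖deriv (snowflake φ k (fun n => θ n x)) w‖) P P) := by
  obtain ⟨L, h⟩ := hφ.exists_isLogRatio
  have hf := h.sigmaPrime_snowflake hφ.injOn hk
  have hc := h.continuousOn_snowflake hk
  have hid : ∀ α : Angles, IdentDistrib (fun x n => θ n x)
      (fun x => shiftAngles k α (fun n => θ n x)) P P := fun α =>
    identDistrib_add_const hlaw hindep fun n => k ^ n • α
  refine ⟨fun t => ⟨hf t, h.tendstoLocallyUniformlyOn_snowflakeApprox hk t⟩, fun ω => ?_,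
    fun z w hzw => ?_, fun z w hz hzw => ?_⟩
  · have h1 := (hid ω).comp (measurable_pi_iff.2 (measurable_inverseSnowflake hf hc))
    convert! h1 using 1
    funext x z
    -- Equivariance at `e^{-iω} z` shows that the rotated function is `g` for the shifted angles,
    -- evaluated at `z`.
    have h2 := h.inverseSnowflake_shiftAngles hφ.injOn hk ω (fun n => θ n x)
      (Complex.exp (-(Complex.I * ω)) * z)
    rw [toCircle_coe_angle, ← mul_assoc, ← Complex.exp_add, add_neg_cancel, Complex.exp_zero,
      one_mul] at h2
    exact h2.symm
  · obtain ⟨α, rfl⟩ := exists_toCircle_mul_eq hzw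
    constructor
    -- Pointwise, `|g(z)|` for the given angles equals `|g(αz)|` for the shifted ones, `α` acting as
    -- a rotation. The shifted angles have the original law. The remaining three cases use the same
    -- argument.
    · have h1 := (hid α).comp (measurable_inverseSnowflake hf hc (AddCircle.toCircle α * z)).norm
      convert! h1.symm using 1
      funext x
      simp only [Function.comp_apply]
      rw [h.inverseSnowflake_shiftAngles hφ.injOn hk, norm_mul, Circle.norm_coe, one_mul]
    · have h1 := (hid α).comp
        (measurable_deriv_inverseSnowflake hf hc (AddCircle.toCircle α * z)).norm
      convert! h1.symm using 1
      funext x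
      exact (h.norm_deriv_inverseSnowflake_shiftAngles hφ.injOn hk α _ z).symm
  · obtain ⟨α, rfl⟩ := exists_toCircle_mul_eq hzw
    have hz1 : z ∈ exteriorDisk := hz
    have hz2 := (circle_mul_mem_exteriorDisk (AddCircle.toCircle α)).2 hz1
    constructor
    · have h1 := (hid α).comp (measurable_snowflake hc hz2).norm
      convert! h1.symm using 1
      funext x
      simp only [Function.comp_apply]
      rw [h.snowflake_shiftAngles hk α _ hz1, norm_mul, Circle.norm_coe, one_mul]
    · have h1 := (hid α).comp (measurable_deriv_snowflake hf hc hz2).norm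
      convert! h1.symm using 1
      funext x
      exact (h.norm_deriv_snowflake_shiftAngles hk α _ hz1).symm
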